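/- Let $K$ be a field, $R=K[x_1,\dots,x_n]$, and fix a variable $y=x_j$. For $f\in R$ let $\mathrm{init}_y f$ be the sum of all terms of $f$ having the highest power of $y$; a monomial order $<$ on $R$ is called $y$-compatible if $\mathrm{init}_<f=\mathrm{init}_<(\mathrm{init}_y f)$ for every $f\in R$. For an ideal $J\subseteq R$, say that $R/J$ is equidimensional if $\dim(R/P)=\dim(R/J)$ for all minimal primes $P$ of $J$. Let $I\subseteq R$ be an ideal such that $R/I$ is equidimensional, and let $G$ be the reduced Gröbner basis of $I$ with respect to a $y$-compatible monomial order. Write $G=\{y^{d_i}q_i+r_i : 1\le i\le m\}$, where $y$ divides no term of $q_i$ and $\mathrm{init}_y(y^{d_i}q_i+r_i)=y^{d_i}q_i$, and put $$C_{y,I}=\langle q_i : 1\le i\le m\rangle,\qquad N_{y,I}=\langle q_i : d_i=0\rangle .$$ Suppose that the Knutson–Miller–Yong decomposition $\sqrt{\mathrm{init}_yI}=\sqrt{C_{y,I}}\cap\sqrt{N_{y,I}+\langle y\rangle}$, where $\mathrm{init}_yI=\langle \mathrm{init}_yf : f\in I\rangle$, is nondegenerate, that is, $\sqrt{C_{y,I}}\neq\sqrt{N_{y,I}}$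 and $C_{y,I}\neq\langle 1\rangle$. Then $$\mathrm{height}(C_{y,I})=\mathrm{height}(I)=\mathrm{height}(N_{y,I})+1,$$ and $R/C_{y,I}$ is equidimensional. -/

import Mathlib

namespace KMY

noncomputable section

open MvPolynomial

/-- `R/I` is equidimensional: `dim (R/P) = dim (R/I)` for every minimal prime `P` of `I`. -/
def QuotientEquidimensional {R : Type*} [CommRing R] (I : Ideal R) : Prop :=
  ∀ P ∈ I.minimalPrimes, ringKrullDim (R ⧸ P) = ringKrullDim (R ⧸ I)

variable {K : Type*} [Field K] {n : ℕ}

/-- The initial `y`-form of `f`, for `y = x_j`: the sum of all terms of `f` with the highest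
power of `y` (and `0` for `f = 0`). -/
def initY (j : Fin n) (f : MvPolynomial (Fin n) K) : MvPolynomial (Fin n) K :=
  ∑ a ∈ f.support with a j = f.degreeOf j, monomial a (f.coeff a)

/-- The monomial order `m` is `y`-compatible, for `y = x_j`: every polynomial has the same
initial term as its initial `y`-form. -/
def YCompatible (K : Type*) [Field K] {n : ℕ} (m : MonomialOrder (Fin n)) (j : Fin n) : Prop :=
  ∀ f : MvPolynomial (Fin n) K, m.leadingTerm f = m.leadingTerm (initY j f)

/-- The initial ideal of a set of polynomials: the ideal generated by their initial terms. -/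
def initialIdeal (m : MonomialOrder (Fin n)) (S : Set (MvPolynomial (Fin n) K)) :
    Ideal (MvPolynomial (Fin n) K) :=
  Ideal.span (m.leadingTerm '' S)

/-- `G` is a Gröbner basis of `I` with respect to `m`. -/
structure IsGroebnerBasis (m : MonomialOrder (Fin n)) (I : Ideal (MvPolynomial (Fin n) K))
    (G : Set (MvPolynomial (Fin n) K)) : Prop where
  finite : G.Finite
  subset : G ⊆ I
  initialIdeal_eq : initialIdeal m G = initialIdeal m (I : Set (MvPolynomial (Fin n) K))

/-- `G` is a reduced Gröbner basis of `I` with respect to `m`: its elements are monic, and no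
monomial of an element `g` is divisible by the leading monomial of another element. -/
structure IsReducedGroebnerBasis (m : MonomialOrder (Fin n)) (I : Ideal (MvPolynomial (Fin n) K))
    (G : Set (MvPolynomial (Fin n) K)) : Prop extends IsGroebnerBasis m I G where
  monic : ∀ g ∈ G, m.leadingCoeff g = 1
  reduced : ∀ g ∈ G, ∀ g' ∈ G, g' ≠ g → ∀ a ∈ g.support, ¬ m.degree g' ≤ a

/-- `g = y ^ d * q + r`, for `y = x_j`, where `y` divides no term of `q` and
`y ^ d * q` is the initial `y`-form of `g`. -/
structure IsYForm (j : Fin n) (g : MvPolynomial (Fin n) K) (d : ℕ)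
    (q r : MvPolynomial (Fin n) K) : Prop where
  eq : g = X j ^ d * q + r
  not_dvd : ∀ a ∈ q.support, a j = 0
  initY_eq : initY j g = X j ^ d * q

/-- The ideal `C_{y,I} = ⟨ q_i ⟩` computed from a Gröbner basis `G = { y ^ d_i * q_i + r_i }`
of `I`, for `y = x_j`. -/
def idealC (j : Fin n) (G : Set (MvPolynomial (Fin n) K)) : Ideal (MvPolynomial (Fin n) K) :=
  Ideal.span {q | ∃ g ∈ G, ∃ d r, IsYForm j g d q r}

/-- The ideal `N_{y,I} = ⟨ q_i : d_i = 0 ⟩` computed from a Gröbner basis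
`G = { y ^ d_i * q_i + r_i }` of `I`, for `y = x_j`. -/
def idealN (j : Fin n) (G : Set (MvPolynomial (Fin n) K)) : Ideal (MvPolynomial (Fin n) K) :=
  Ideal.span {q | ∃ g ∈ G, ∃ r, IsYForm j g 0 q r}

/-- The Knutson-Miller-Yong decomposition given by the Gröbner basis `G` is degenerate:
`√C = √N` or `C = ⟨1⟩`. -/
def Degenerate (j : Fin n) (G : Set (MvPolynomial (Fin n) K)) : Prop :=
  (idealC j G).radical = (idealN j G).radical ∨ idealC j G = ⊤

end

end KMY

/-!
Write `R = A[y]`, where `A` is the polynomial ring in the variables other than `y`. Because the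
order is `y`-compatible, division by the Gröbner basis controls the degree in `y`. Hence `C_{y,I}`
is the extension to `R` of the ideal `L ⊆ A` of leading coefficients of elements of `I`, and
`N_{y,I}` is the extension of `I ∩ A` (`IsReducedGroebnerBasis.map_idealC_eq`,
`IsReducedGroebnerBasis.map_idealN_eq`). Extension from `A` to `R` preserves heights and sends
minimal primes to minimal primes, so the claim is about `L` and `I ∩ A`. By the dimension formula
(`height_add_ringKrullDim_quotient`), equidimensionality of `R ⧸ I` says that all minimal primes of
`I` have the same height `h`.

The zero locus of `L` is the part at infinity of the zero locus of `I`. Substituting `y = t⁻¹` gives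
an ideal `reversedIdeal I` of `A[t]` whose minimal primes are those of `I` that do not contain `y`,
seen in `A[t, t⁻¹]`. They have height `h` and do not contain `t`, and `L` is the reduction of
`reversedIdeal I` modulo `t`. By Krull's principal ideal theorem and the dimension formula, every
minimal prime of `L` has height `h` (`height_of_mem_minimalPrimes_leadingCoeff`). When `C_{y,I} ≠
⟨1⟩` this gives the height of `C_{y,I}` and its equidimensionality.

A minimal prime of `I ∩ A` is the contraction of a minimal prime `P` of `I`. Its height is `h` if
`P` is extended from `A`, and `h - 1` otherwise. If all minimal primes of `I` were extended, the
coefficients of the elements of `I` would lie in the radical of `I ∩ A`, and the radicals of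
`C_{y,I}` and `N_{y,I}` would agree. So nondegeneracy gives height `h - 1`
(`height_comap_C_add_one`).
-/

/-! ### Dimension theory of finitely generated algebras over a field -/

namespace KMY

open Ideal

/-- An injective integral extension preserves Krull dimension: incomparability gives `≤`, lying over
and going up give `≥`. -/
theorem ringKrullDim_eq_of_isIntegral_of_injective {R S : Type*} [CommRing R] [CommRing S]
    [Algebra R S] [Algebra.IsIntegral R S]
    (h : Function.Injective (algebraMap R S)) : ringKrullDim S = ringKrullDim R := by
  apply le_antisymm
  · refine Order.krullDim_le_of_strictMono (PrimeSpectrum.comap (algebraMap R S)) ?_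
    intro P Q hPQ
    exact IsIntegral.comap_lt_comap hPQ
  · refine iSup_le fun l ↦ ?_
    have := l.head.isPrime
    obtain ⟨P, -, hP, hPl⟩ := exists_ideal_over_prime_of_isIntegral (S := S)
      l.head.asIdeal ⊥ (by
        rw [← RingHom.ker_eq_comap_bot, (RingHom.injective_iff_ker_eq_bot _).mp h]; exact bot_le)
    have : P.LiesOver l.head.asIdeal := ⟨hPl.symm⟩
    obtain ⟨L, hL, -⟩ := exists_ltSeries_of_hasGoingUp l P
    rw [← hL]
    exact le_iSup (fun L : LTSeries (PrimeSpectrum S) ↦ ((L.length : ℕ) : WithBot ℕ∞)) L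

theorem height_of_isMaximal_mvPolynomial {k : Type*} [Field k] (s : ℕ)
    (M : Ideal (MvPolynomial (Fin s) k)) [hM : M.IsMaximal] : M.height = s := by
  induction s with
  | zero =>
    have : M = ⊥ := by
      have := (MvPolynomial.isEmptyAlgEquiv k (Fin 0)).toMulEquiv.isField (Field.toIsField k)
      let _ := this.toField
      exact (Ideal.eq_bot_or_top M).resolve_right hM.ne_top
    simp [this]
  | succ s ih =>
    let e := (MvPolynomial.finSuccEquiv k s).toRingEquiv
    have : (M.map e).IsMaximal := map_isMaximal_of_equiv e
    have := Polynomial.isMaximal_comap_C_of_isJacobsonRing (M.map e)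
    have : (M.map e).LiesOver ((M.map e).comap Polynomial.C) := ⟨rfl⟩
    rw [← e.height_map M, Polynomial.height_eq_height_add_one ((M.map e).comap Polynomial.C),
      ih ((M.map e).comap Polynomial.C)]
    norm_cast

/-- A prime of height one in a finitely generated domain `A` over a field lowers the dimension by
exactly one. By Noether normalization `A` is integral over a polynomial ring `B`. Going down shows
that the prime contracts to a prime of height one of `B`, which is principal, and there the claim
holds because all maximal ideals of `B` have the same height. -/
theorem ringKrullDim_quotient_add_one_of_height_eq_one (k : Type*) {A : Type*} [Field k]
    [CommRing A] [IsDomain A]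
    [Algebra k A] [Algebra.FiniteType k A] (Q : Ideal A) [Q.IsPrime] (hQ : Q.height = 1) :
    ringKrullDim (A ⧸ Q) + 1 = ringKrullDim A := by
  have := Algebra.FiniteType.isNoetherianRing k A
  obtain ⟨s, g, hg, hgi⟩ := exists_integral_inj_algHom_of_fg k A
  algebraize [g.toRingHom]
  have : FaithfulSMul (MvPolynomial (Fin s) k) A := (faithfulSMul_iff_algebraMap_injective _ _).mpr hg
  set q := Q.under (MvPolynomial (Fin s) k) with hq
  have hq1 : q.height ≤ 1 := by
    rw [← hQ, Ideal.height_eq_height_add_of_liesOver_of_hasGoingDown q Q]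
    exact le_self_add
  have hq0 : q ≠ ⊥ := Ideal.IsIntegral.comap_ne_bot _ (Ideal.ne_bot_of_height_eq_one hQ)
  obtain ⟨f, hfq, hf⟩ := Ideal.IsPrime.exists_mem_prime_of_ne_bot (inferInstanceAs q.IsPrime) hq0
  have hqf : q = span {f} := by
    refine Ideal.eq_span_singleton_of_height_eq_one (le_antisymm hq1 ?_) hfq hf
    rw [Order.one_le_iff_ne_zero]
    simpa [Ideal.height_eq_zero_iff_eq_bot] using hq0
  obtain ⟨M, hM, hqM⟩ := Ideal.exists_le_maximal q Ideal.IsPrime.ne_top'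
  have h1 : ringKrullDim (MvPolynomial (Fin s) k ⧸ q) + 1 =
      ringKrullDim (MvPolynomial (Fin s) k) := by
    rw [hqf]
    refine Module.ringKrullDim_quotient_add_one_of_mem_nonZeroDivisors
      (mem_nonZeroDivisors_of_ne_zero hf.ne_zero) (p := M) ?_ (hqM hfq)
    rw [height_of_isMaximal_mvPolynomial s M]
    simp
  rw [ringKrullDim_eq_of_isIntegral_of_injective (R := MvPolynomial (Fin s) k) (S := A) hg, ← h1,
    ringKrullDim_eq_of_isIntegral_of_injective (R := MvPolynomial (Fin s) k ⧸ q) (S := A ⧸ Q)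
      Ideal.algebraMap_quotient_injective]

/-- The dimension formula for a finitely generated domain over a field: a prime `P` contains a prime
`P'` of height one less, and then `P / P'` has height one in `A ⧸ P'`. -/
theorem height_add_ringKrullDim_quotient (k : Type*) {A : Type*} [Field k]
    [CommRing A] [IsDomain A] [Algebra k A] [Algebra.FiniteType k A] (P : Ideal A) [hP : P.IsPrime] :
    (P.height : WithBot ℕ∞) + ringKrullDim (A ⧸ P) = ringKrullDim A := by
  have := Algebra.FiniteType.isNoetherianRing k A
  obtain ⟨h, hh⟩ := ENat.ne_top_iff_exists.mp (P.height_ne_top hP.ne_top)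
  induction h generalizing P with
  | zero =>
    have : P = ⊥ := by
      rw [← Ideal.height_eq_zero_iff_eq_bot, ← hh]; rfl
    subst this
    simp [ringKrullDim_eq_of_ringEquiv (RingEquiv.quotientBot A)]
  | succ h ih =>
    obtain ⟨P', hP', hlt, hht⟩ : ∃ P' : Ideal A, P'.IsPrime ∧ P' < P ∧ (h : ℕ∞) = P'.height := by
      by_contra! H
      have : P.height ≤ h := by
        rw [Ideal.height_le_iff]
        intro q hq hqP
        refine lt_of_le_of_ne ?_ (H q hq hqP).symm
        have := Ideal.height_add_one_le_of_lt_of_isPrime hqP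
        rw [← hh] at this
        exact_mod_cast (ENat.add_le_add_iff_right ENat.one_ne_top).mp this
      rw [← hh] at this
      exact absurd this (by norm_cast; omega)
    have e := ih P' hht
    set Q := P.map (Ideal.Quotient.mk P') with hQ
    have : Q.IsPrime := Ideal.isPrime_map_quotientMk_of_isPrime hlt.le
    -- a nonzero prime strictly below `Q` would pull back to a prime strictly between `P'` and `P`
    have hQ1 : Q.height = 1 := by
      apply le_antisymm
      · refine (Ideal.height_le_iff (n := 1)).mpr fun q hq hqQ ↦ ?_
        suffices q = ⊥ by simp [this]
        by_contra hq0
        have h1 : P' < q.comap (Ideal.Quotient.mk P') := by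
          refine lt_of_le_of_ne ?_ fun h ↦ hq0 ?_
          · conv_lhs => rw [← Ideal.mk_ker (I := P'), RingHom.ker_eq_comap_bot]
            exact Ideal.comap_mono bot_le
          · rw [← Ideal.map_comap_of_surjective _ Ideal.Quotient.mk_surjective q, ← h,
              Ideal.map_quotient_self]
        have h2 : q.comap (Ideal.Quotient.mk P') < P := by
          have : q.comap (Ideal.Quotient.mk P') < Q.comap (Ideal.Quotient.mk P') :=
            (Ideal.comap_mono hqQ.le).lt_of_ne fun h ↦ hqQ.ne
              (Ideal.comap_injective_of_surjective _ Ideal.Quotient.mk_surjective h)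
          rwa [hQ, Ideal.comap_map_quotientMk, sup_eq_right.mpr hlt.le] at this
        have h3 := (add_le_add_left (Ideal.height_add_one_le_of_lt_of_isPrime h1) 1).trans
          (Ideal.height_add_one_le_of_lt_of_isPrime h2)
        rw [← hh, ← hht] at h3
        norm_cast at h3
        omega
      · rw [Order.one_le_iff_ne_zero]
        simp only [ne_eq, Ideal.height_eq_zero_iff_eq_bot]
        rw [hQ, Ideal.map_eq_bot_iff_le_ker, Ideal.mk_ker]
        exact hlt.not_ge
    have e2 := ringKrullDim_quotient_add_one_of_height_eq_one k Q hQ1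
    rw [ringKrullDim_eq_of_ringEquiv (DoubleQuot.quotQuotEquivQuotOfLE hlt.le)] at e2
    rw [← e, ← e2, ← hh, ← hht]
    push_cast
    rw [add_assoc, add_comm 1]

theorem exists_ringKrullDim_eq_natCast (k : Type*) (A : Type*) [Field k]
    [CommRing A] [Nontrivial A] [Algebra k A] [Algebra.FiniteType k A] :
    ∃ d : ℕ, ringKrullDim A = d := by
  obtain ⟨s, g, hg, hgi⟩ := exists_integral_inj_algHom_of_fg k A
  algebraize [g.toRingHom]
  refine ⟨s, ?_⟩
  rw [ringKrullDim_eq_of_isIntegral_of_injective (R := MvPolynomial (Fin s) k) (S := A) hg]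
  simp

/-- The dimension formula `height_add_ringKrullDim_quotient` in terms of natural numbers. -/
theorem exists_height_add_ringKrullDim_quotient (k : Type*) {A : Type*} [Field k]
    [CommRing A] [IsDomain A] [Algebra k A] [Algebra.FiniteType k A] {N : ℕ}
    (hN : ringKrullDim A = N) (P : Ideal A) [hP : P.IsPrime] :
    ∃ a b : ℕ, P.height = a ∧ ringKrullDim (A ⧸ P) = b ∧ a + b = N := by
  have := Algebra.FiniteType.isNoetherianRing k A
  obtain ⟨a, ha⟩ := ENat.ne_top_iff_exists.mp (P.height_ne_top hP.ne_top)
  obtain ⟨b, hb⟩ := exists_ringKrullDim_eq_natCast k (A ⧸ P)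
  refine ⟨a, b, ha.symm, hb, ?_⟩
  have := height_add_ringKrullDim_quotient k P
  rw [← ha, hb, hN] at this
  exact_mod_cast this

/-- If all minimal primes of `J` have height `h` and none of them contains `t`, then all minimal
primes of `J + (t)` have height exactly `h + 1`: such a prime has height one modulo a minimal prime
of `J` by Krull's principal ideal theorem, and heights add up by the dimension formula. -/
theorem height_eq_add_one_of_mem_minimalPrimes_sup_span_singleton (k : Type*) {A : Type*} [Field k]
    [CommRing A] [IsDomain A] [Algebra k A] [Algebra.FiniteType k A] {J Q : Ideal A} {t : A}
    {h : ℕ∞} (hJ : ∀ P ∈ J.minimalPrimes, P.height = h) (ht : ∀ P ∈ J.minimalPrimes, t ∉ P)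
    (hQ : Q ∈ (J ⊔ span {t}).minimalPrimes) : Q.height = h + 1 := by
  have := Algebra.FiniteType.isNoetherianRing k A
  have hQp : Q.IsPrime := hQ.1.1
  obtain ⟨P, hP, hPQ⟩ := Ideal.exists_minimalPrimes_le (le_sup_left.trans hQ.1.2)
  have hPp : P.IsPrime := hP.1.1
  have htQ : t ∈ Q := hQ.1.2 (Ideal.mem_sup_right (Ideal.mem_span_singleton_self t))
  have hQP : Q ∈ (P ⊔ span {t}).minimalPrimes :=
    ⟨⟨hQp, sup_le hPQ (by simpa [Ideal.span_le] using htQ)⟩, fun q hq hqQ ↦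
      hQ.2 ⟨hq.1, (sup_le_sup_right hP.1.2 _).trans hq.2⟩ hqQ⟩
  have : (Q.map (Ideal.Quotient.mk P)).IsPrime := Ideal.isPrime_map_quotientMk_of_isPrime hPQ
  have h1 : (Q.map (Ideal.Quotient.mk P)).height = 1 := by
    refine le_antisymm (Ideal.map_height_le_one_of_mem_minimalPrimes hQP) ?_
    rw [Order.one_le_iff_ne_zero, ne_eq, Ideal.height_eq_zero_iff_eq_bot,
      Ideal.map_eq_bot_iff_le_ker, Ideal.mk_ker]
    exact fun h ↦ ht P hP (h htQ)
  have e := ringKrullDim_quotient_add_one_of_height_eq_one k _ h1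
  rw [ringKrullDim_eq_of_ringEquiv (DoubleQuot.quotQuotEquivQuotOfLE hPQ)] at e
  obtain ⟨N, hN⟩ := exists_ringKrullDim_eq_natCast k A
  obtain ⟨a, b, ha, hb, hab⟩ := exists_height_add_ringKrullDim_quotient k hN P
  obtain ⟨a', b', ha', hb', hab'⟩ := exists_height_add_ringKrullDim_quotient k hN Q
  rw [hb, hb'] at e
  rw [← hJ P hP, ha', ha]
  norm_cast at e ⊢
  omega

end KMY

/-! ### Heights of ideals in a polynomial ring in one variable -/

namespace KMY

open Ideal Polynomial

section Noetherian

variable {A : Type*} [CommRing A]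

theorem comap_C_map_C (p : Ideal A) : (p.map (C : A →+* A[X])).comap C = p := by
  ext x
  simp only [Ideal.mem_comap, Ideal.mem_map_C_iff, coeff_C]
  constructor
  · intro h
    simpa using h 0
  · intro h n
    split_ifs <;> simp [h]

theorem height_map_C_of_isPrime [IsNoetherianRing A] (p : Ideal A) [p.IsPrime] :
    (p.map (C : A →+* A[X])).height = p.height := by
  have : (p.map (C : A →+* A[X])).LiesOver p := ⟨(comap_C_map_C p).symm⟩
  have : (p.map (C : A →+* A[X])).IsPrime := Ideal.isPrime_map_C_of_isPrime
  simp [height_eq_height_add_of_liesOver_of_hasGoingDown p]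

attribute [local instance] Polynomial.algebra Polynomial.isLocalization in
/-- A prime of `A[X]` lying over zero survives in `F[X]`, where `F` is the fraction field of `A`, and
`F[X]` has dimension one. -/
theorem height_le_one_of_comap_C_eq_bot [IsDomain A] (Q : Ideal A[X]) [Q.IsPrime]
    (hQ : Q.comap C = ⊥) : Q.height ≤ 1 := by
  let F := FractionRing A
  have disj : Disjoint ((nonZeroDivisors A).map C : Set A[X]) Q := by
    refine Set.disjoint_left.mpr fun a ⟨b, hb, hab⟩ ha ↦ ?_
    have : b ∈ Q.comap C := by simpa [hab] using ha
    rw [hQ, Ideal.mem_bot] at this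
    exact nonZeroDivisors.ne_zero hb this
  rw [← IsLocalization.height_map_of_disjoint (S := F[X]) ((nonZeroDivisors A).map C) Q disj]
  have := IsLocalization.isPrime_of_isPrime_disjoint ((nonZeroDivisors A).map C) F[X] Q
    inferInstance disj
  have := Ideal.height_le_ringKrullDim_of_isPrime (I := Q.map (algebraMap A[X] F[X]))
  rw [Polynomial.ringKrullDim_of_isNoetherianRing, ringKrullDim_eq_zero_of_field] at this
  exact_mod_cast this

/-- Modulo the extension of `p = P ∩ A`, the prime `P` becomes a prime of `(A ⧸ p)[X]` lying over
zero, hence of height at most one. -/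
theorem height_le_height_comap_C_add_one [IsNoetherianRing A] (P : Ideal A[X]) [P.IsPrime] :
    P.height ≤ (P.comap C).height + 1 := by
  set p := P.comap C with hp
  have : P.LiesOver p := ⟨rfl⟩
  refine (Ideal.height_le_height_add_of_liesOver p P).trans (add_le_add_right ?_ _)
  have hle : p.map (C : A →+* A[X]) ≤ P := Ideal.map_comap_le
  have : (P.map (Ideal.Quotient.mk (p.map (algebraMap A A[X])))).IsPrime :=
    Ideal.isPrime_map_quotientMk_of_isPrime hle
  let e : (A[X] ⧸ p.map (C : A →+* A[X])) ≃+* (A ⧸ p)[X] :=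
    (polynomialQuotientEquivQuotientPolynomial p).symm
  rw [← e.height_map]
  have : ((P.map (Ideal.Quotient.mk (p.map (algebraMap A A[X])))).map e).IsPrime :=
    Ideal.map_isPrime_of_equiv e
  refine height_le_one_of_comap_C_eq_bot _ ?_
  rw [eq_bot_iff]
  intro x hx
  obtain ⟨x, rfl⟩ := Ideal.Quotient.mk_surjective x
  have hex : C (Ideal.Quotient.mk p x) = e (Ideal.Quotient.mk _ (C x)) := by
    simp [e]
  rw [Ideal.mem_comap, hex, Ideal.mem_map_of_equiv] at hx
  obtain ⟨y, hy, hyx⟩ := hx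
  rw [e.injective hyx] at hy
  exact Ideal.Quotient.eq_zero_iff_mem.mpr ((Ideal.mem_quotient_iff_mem hle).mp hy)

theorem exists_eq_map_C_of_mem_minimalPrimes_map_C {J : Ideal A} {P : Ideal A[X]}
    (hP : P ∈ (J.map (C : A →+* A[X])).minimalPrimes) : ∃ p ∈ J.minimalPrimes, P = p.map C := by
  have := hP.1.1
  obtain ⟨p, hp, hpP⟩ := Ideal.exists_minimalPrimes_le (Ideal.map_le_iff_le_comap.mp hP.1.2)
  have := hp.1.1
  have hle := Ideal.map_le_iff_le_comap.mpr hpP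
  exact ⟨p, hp, (hP.2 ⟨Ideal.isPrime_map_C_of_isPrime, Ideal.map_mono hp.1.2⟩ hle).antisymm hle⟩

theorem height_ideal_map_C [IsNoetherianRing A] (J : Ideal A) :
    (J.map (C : A →+* A[X])).height = J.height := by
  rw [Ideal.height_eq_inf_minimalPrimes, J.height_eq_inf_minimalPrimes]
  apply le_antisymm
  · refine le_iInf₂ fun p hp ↦ ?_
    have := hp.1.1
    rw [← height_map_C_of_isPrime p, ← Ideal.height_eq_inf_minimalPrimes]
    exact Ideal.height_mono (Ideal.map_mono hp.1.2)
  · refine le_iInf₂ fun P hP ↦ ?_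
    obtain ⟨p, hp, rfl⟩ := exists_eq_map_C_of_mem_minimalPrimes_map_C hP
    have := hp.1.1
    rw [height_map_C_of_isPrime p]
    exact iInf₂_le p hp

end Noetherian

/-! ### The ideal of leading coefficients as a hyperplane section -/

section Reversed

variable {A : Type*} [CommRing A]

open LaurentPolynomial

/-- The ideal of `A[t]` obtained from `I ⊆ A[X]` by the substitution `X = t⁻¹`: the polynomials in
`t` that lie in the image of `I` in `A[t, t⁻¹]`. Geometrically this is the closure of the zero locus
of `I` in a neighbourhood of `X = ∞`. As `invert` is an involution, taking the preimage under it is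
the same as taking the image. -/
noncomputable def reversedIdeal (I : Ideal A[X]) : Ideal A[X] :=
  ((I.map (toLaurent (R := A))).comap (invert (R := A)).toRingHom).comap (toLaurent (R := A))

theorem reverse_mem_reversedIdeal {I : Ideal A[X]} {f : A[X]} (hf : f ∈ I) :
    f.reverse ∈ reversedIdeal I := by
  simp only [reversedIdeal, Ideal.mem_comap, toLaurent_reverse]
  simp only [map_mul]
  refine Ideal.mul_mem_right _ _ ?_
  have : invert (invert (toLaurent f)) = toLaurent f := involutive_invert _
  simpa [this] using Ideal.mem_map_of_mem _ hf

theorem coeff_zero_mem_leadingCoeff_of_mem_reversedIdeal {I : Ideal A[X]} {g : A[X]}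
    (hg : g ∈ reversedIdeal I) :
    g.coeff 0 ∈ I.leadingCoeff := by
  by_cases h0 : g.coeff 0 = 0
  · simp [h0]
  have hg' : toLaurent g.reverse ∈ I.map (toLaurent (R := A)) := by
    rw [toLaurent_reverse]
    exact Ideal.mul_mem_right _ _ hg
  have := (IsLocalization.algebraMap_mem_map_algebraMap_iff (Submonoid.powers (X : A[X])) A[T;T⁻¹]
    I g.reverse).mp hg'
  obtain ⟨-, ⟨k, rfl⟩, hk⟩ := this
  rw [Ideal.mem_leadingCoeff]
  refine ⟨_, hk, ?_⟩
  have : (X ^ k * g.reverse).leadingCoeff = g.reverse.leadingCoeff := by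
    rw [mul_comm, leadingCoeff_mul_X_pow]
  rw [this, reverse_leadingCoeff, trailingCoeff, natTrailingDegree_eq_zero.mpr (Or.inr h0)]

/-- The ideal of leading coefficients of `I` cuts out the points at infinity: it is the reduction of
`reversedIdeal I` modulo `t`. -/
theorem comap_constantCoeff_leadingCoeff (I : Ideal A[X]) :
    I.leadingCoeff.comap (constantCoeff (R := A)) = reversedIdeal I ⊔ span {X} := by
  apply le_antisymm
  · intro g hg
    rw [Ideal.mem_comap, constantCoeff_apply, Ideal.mem_leadingCoeff] at hg
    obtain ⟨f, hf, hfg⟩ := hg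
    have : g = f.reverse + (g - f.reverse) := by ring
    rw [this]
    refine add_mem (Ideal.mem_sup_left (reverse_mem_reversedIdeal hf)) (Ideal.mem_sup_right ?_)
    rw [Ideal.mem_span_singleton, X_dvd_iff]
    simp [hfg]
  · refine sup_le (fun g hg ↦ coeff_zero_mem_leadingCoeff_of_mem_reversedIdeal hg) ?_
    simp [Ideal.span_le]

/-- The minimal primes of `reversedIdeal I` come from minimal primes of `I` that survive in the
localization `A[X, X⁻¹]`, and localizing preserves heights. -/
theorem height_eq_and_X_notMem_of_mem_minimalPrimes_reversedIdeal {I : Ideal A[X]} {h : ℕ∞}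
    (hI : ∀ P ∈ I.minimalPrimes, P.height = h) {Q : Ideal A[X]}
    (hQ : Q ∈ (reversedIdeal I).minimalPrimes) : Q.height = h ∧ X ∉ Q := by
  obtain ⟨P, hP, rfl⟩ := Ideal.exists_minimalPrimes_comap_eq _ Q hQ
  obtain ⟨P', hP', rfl⟩ := Ideal.exists_minimalPrimes_comap_eq _ P hP
  have hp := hP.1.1
  have hp' := hP'.1.1
  constructor
  · have e1 := IsLocalization.height_under (Submonoid.powers (X : A[X]))
      (P'.comap (invert (R := A)).toRingEquiv.toRingHom)
    have e2 := IsLocalization.height_under (Submonoid.powers (X : A[X])) P'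
    have e3 : P'.under A[X] ∈ I.minimalPrimes := by
      have := IsLocalization.minimalPrimes_map (Submonoid.powers (X : A[X])) A[T;T⁻¹] I
      exact this.le hP'
    refine e1.trans ?_
    rw [← hI _ e3, e2]
    exact (invert (R := A)).toRingEquiv.height_comap P'
  · intro hX
    rw [Ideal.mem_comap] at hX
    refine hp.ne_top (Ideal.eq_top_of_isUnit_mem _ hX ?_)
    rw [toLaurent_X]
    exact isUnit_T 1

end Reversed

/-- The ideal `p + (X)` of `A[X]` has height one more than the prime `p`, as both have the same
quotient ring. -/
theorem height_comap_constantCoeff (k : Type*) {A : Type*} [Field k] [CommRing A] [IsDomain A]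
    [Algebra k A] [Algebra.FiniteType k A] (p : Ideal A) [p.IsPrime] :
    (p.comap (constantCoeff (R := A))).height = p.height + 1 := by
  have := Algebra.FiniteType.isNoetherianRing k A
  have : Algebra.FiniteType k A[X] := Algebra.FiniteType.trans (S := A) inferInstance inferInstance
  obtain ⟨N, hN⟩ := exists_ringKrullDim_eq_natCast k A
  have hN' : ringKrullDim A[X] = (N + 1 : ℕ) := by
    rw [Polynomial.ringKrullDim_of_isNoetherianRing, hN]
    norm_cast
  have hs : Function.Surjective (constantCoeff (R := A)) := fun a ↦ ⟨C a, by simp⟩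
  obtain ⟨a, b, ha, hb, hab⟩ := exists_height_add_ringKrullDim_quotient k hN p
  obtain ⟨a', b', ha', hb', hab'⟩ := exists_height_add_ringKrullDim_quotient k hN'
    (p.comap (constantCoeff (R := A)))
  have e : ringKrullDim (A[X] ⧸ p.comap (constantCoeff (R := A))) = ringKrullDim (A ⧸ p) := by
    have hker : RingHom.ker ((Ideal.Quotient.mk p).comp constantCoeff) =
        p.comap (constantCoeff (R := A)) := by
      rw [← RingHom.comap_ker, Ideal.mk_ker]
    rw [← hker]
    exact ringKrullDim_eq_of_ringEquiv
      (RingHom.quotientKerEquivOfSurjective (Ideal.Quotient.mk_surjective.comp hs))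
  rw [hb, hb'] at e
  rw [ha, ha']
  norm_cast at e ⊢
  omega

/-- If all minimal primes of `I` have height `h`, so do those of the ideal of leading coefficients:
it is a section of `reversedIdeal I` by the hypersurface `t = 0`, which contains no component. -/
theorem height_of_mem_minimalPrimes_leadingCoeff (k : Type*) {A : Type*} [Field k] [CommRing A]
    [IsDomain A] [Algebra k A] [Algebra.FiniteType k A] {I : Ideal A[X]} {h : ℕ∞}
    (hI : ∀ P ∈ I.minimalPrimes, P.height = h)
    {p : Ideal A} (hp : p ∈ I.leadingCoeff.minimalPrimes) : p.height = h := by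
  have : Algebra.FiniteType k A[X] := Algebra.FiniteType.trans (S := A) inferInstance inferInstance
  have hs : Function.Surjective (constantCoeff (R := A)) := fun a ↦ ⟨C a, by simp⟩
  have hQ := Ideal.minimalPrimes_comap_of_surjective hs hp
  rw [comap_constantCoeff_leadingCoeff] at hQ
  have h1 := height_eq_add_one_of_mem_minimalPrimes_sup_span_singleton k
    (fun P hP ↦ (height_eq_and_X_notMem_of_mem_minimalPrimes_reversedIdeal hI hP).1)
    (fun P hP ↦ (height_eq_and_X_notMem_of_mem_minimalPrimes_reversedIdeal hI hP).2) hQ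
  have := hp.1.1
  rw [height_comap_constantCoeff k] at h1
  exact ENat.add_left_injective_of_ne_top ENat.one_ne_top h1

/-- If all minimal primes of `I` are extended from `A`, then every coefficient of an element of `I`
lies in all of their contractions. -/
theorem leadingCoeff_le_radical_comap_C {A : Type*} [CommRing A] {I : Ideal A[X]}
    (hI : ∀ P ∈ I.minimalPrimes, P = (P.comap C).map C) :
    I.leadingCoeff ≤ (I.comap C).radical := by
  intro a ha
  obtain ⟨f, hf, rfl⟩ := (I.mem_leadingCoeff a).mp ha
  rw [← Ideal.comap_radical, Ideal.mem_comap, ← Ideal.sInf_minimalPrimes, Ideal.mem_sInf]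
  intro P hP
  have hfP : f ∈ (P.comap C).map C := (hI P hP).le (hP.1.2 hf)
  exact Ideal.mem_map_C_iff.mp hfP f.natDegree

/-- If all minimal primes of `I` have height `h`, contracting one of them to `A` lowers the height by
one, unless it is extended from `A`. By `leadingCoeff_le_radical_comap_C` some minimal prime is not
extended. -/
theorem height_comap_C_add_one {A : Type*} [CommRing A] [IsNoetherianRing A] {I : Ideal A[X]}
    {h : ℕ∞} (hI : ∀ P ∈ I.minimalPrimes, P.height = h)
    (hrad : ¬ I.leadingCoeff ≤ (I.comap C).radical) : (I.comap C).height + 1 = h := by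
  apply le_antisymm
  · obtain ⟨P, hP, hne⟩ : ∃ P ∈ I.minimalPrimes, P ≠ (P.comap C).map C := by
      by_contra! H
      exact hrad (leadingCoeff_le_radical_comap_C H)
    have := hP.1.1
    have hlt : (P.comap C).map C < P := Ideal.map_comap_le.lt_of_ne hne.symm
    rw [← hI P hP]
    refine le_trans ?_ (Ideal.height_add_one_le_of_lt_of_isPrime hlt)
    rw [height_map_C_of_isPrime]
    exact add_le_add_left (Ideal.height_mono (Ideal.comap_mono hP.1.2)) 1
  -- a minimal prime of `I ∩ A` is the contraction of a minimal prime of `I`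
  · have hne : I.comap C ≠ ⊤ := by
      intro H
      rw [H, Ideal.radical_top] at hrad
      exact hrad le_top
    obtain ⟨a, ha⟩ := ENat.ne_top_iff_exists.mp (Ideal.height_ne_top hne)
    obtain ⟨q, hq, hIq, hqa⟩ := Ideal.exists_isPrime_height_eq ha.symm
    obtain ⟨p, hp, hpq⟩ := Ideal.exists_minimalPrimes_le hIq
    obtain ⟨P, hP, rfl⟩ := Ideal.exists_minimalPrimes_comap_eq _ p hp
    have := hP.1.1
    rw [← hI P hP, ← ha, ← hqa]
    exact (height_le_height_comap_C_add_one P).trans (add_le_add_left (Ideal.height_mono hpq) 1)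

end KMY

/-! ### Initial forms and Gröbner bases in terms of polynomials in `y` -/

namespace KMY

open MvPolynomial

variable {K : Type*} [Field K] {n : ℕ}

/-- The polynomial ring in `n` variables as a ring of polynomials in `y = x_j`, with coefficients in
the polynomial ring in the other variables. -/
noncomputable def yEquiv (K : Type*) [Field K] {n : ℕ} (j : Fin n) :
    MvPolynomial (Fin n) K ≃ₐ[K] Polynomial (MvPolynomial {i : Fin n // i ≠ j} K) :=
  (renameEquiv K (Equiv.optionSubtypeNe j).symm).trans (optionEquivLeft K _)

theorem yEquiv_X (j : Fin n) : yEquiv K j (X j) = Polynomial.X := by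
  simp [yEquiv, -Equiv.optionSubtypeNe_symm_apply, Equiv.optionSubtypeNe_symm_self]

theorem natDegree_yEquiv (j : Fin n) (f : MvPolynomial (Fin n) K) :
    (yEquiv K j f).natDegree = f.degreeOf j :=
  (degreeOf_eq_natDegree j f).symm

theorem exists_yEquiv_monomial (j : Fin n) (a : Fin n →₀ ℕ) (c : K) :
    ∃ b, yEquiv K j (monomial a c) = Polynomial.monomial (a j) b := by
  refine ⟨monomial (Finsupp.mapDomain (Equiv.optionSubtypeNe j).symm a).some c, ?_⟩
  rw [yEquiv, AlgEquiv.trans_apply, renameEquiv_apply, rename_monomial, optionEquivLeft_monomial]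
  have h := Finsupp.mapDomain_apply (Equiv.optionSubtypeNe j).symm.injective a j
  rw [Equiv.optionSubtypeNe_symm_self] at h
  rw [h]

theorem yEquiv_initY (j : Fin n) (f : MvPolynomial (Fin n) K) :
    yEquiv K j (initY j f) =
      Polynomial.monomial (f.degreeOf j) (yEquiv K j f).leadingCoeff := by
  choose b hb using exists_yEquiv_monomial (K := K) j
  have hf : yEquiv K j f =
      ∑ a ∈ f.support, Polynomial.monomial (a j) (b a (f.coeff a)) := by
    conv_lhs => rw [f.as_sum, map_sum]
    exact Finset.sum_congr rfl fun a _ ↦ hb a _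
  rw [Polynomial.leadingCoeff, natDegree_yEquiv, hf, Polynomial.finsetSum_coeff, initY, map_sum,
    map_sum, Finset.sum_filter]
  refine Finset.sum_congr rfl fun a _ ↦ ?_
  rw [Polynomial.coeff_monomial, hb]
  split_ifs with h
  · rw [h]
  · simp

theorem forall_support_apply_eq_zero_iff_natDegree_yEquiv_eq_zero (j : Fin n)
    (q : MvPolynomial (Fin n) K) :
    (∀ a ∈ q.support, a j = 0) ↔ (yEquiv K j q).natDegree = 0 := by
  rw [natDegree_yEquiv, ← Nat.le_zero, degreeOf_le_iff]
  simp

/-- In a decomposition `g = y ^ d * q + r`, the polynomial `q` is the leading coefficient of `g`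
with respect to `y`, and `d` is the degree in `y`. The zero polynomial has such a decomposition for
every `d`, with `q = 0`. -/
theorem IsYForm.yEquiv_eq {j : Fin n} {g : MvPolynomial (Fin n) K} {d : ℕ}
    {q r : MvPolynomial (Fin n) K} (h : IsYForm j g d q r) :
    yEquiv K j q = Polynomial.C (yEquiv K j g).leadingCoeff ∧ (g ≠ 0 → g.degreeOf j = d) := by
  have h1 := congrArg (yEquiv K j) h.initY_eq
  obtain ⟨c, hc⟩ : ∃ c, yEquiv K j q = Polynomial.C c :=
    ⟨_, Polynomial.eq_C_of_natDegree_eq_zero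
      ((forall_support_apply_eq_zero_iff_natDegree_yEquiv_eq_zero j q).mp h.not_dvd)⟩
  rw [yEquiv_initY, map_mul, map_pow, yEquiv_X, hc, mul_comm, Polynomial.C_mul_X_pow_eq_monomial]
    at h1
  have h2 : (yEquiv K j g).leadingCoeff = c := by
    simpa using congrArg Polynomial.leadingCoeff h1
  refine ⟨by rw [hc, h2], fun hg ↦ ?_⟩
  have hl : (yEquiv K j g).leadingCoeff ≠ 0 := by simpa using hg
  have h3 := congrArg Polynomial.natDegree h1
  rwa [Polynomial.natDegree_monomial_eq _ hl, Polynomial.natDegree_monomial_eq _ (h2 ▸ hl)] at h3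

theorem exists_isYForm (j : Fin n) (g : MvPolynomial (Fin n) K) :
    ∃ r, IsYForm j g (g.degreeOf j)
      ((yEquiv K j).symm (Polynomial.C (yEquiv K j g).leadingCoeff)) r := by
  refine ⟨g - initY j g, ?_⟩
  have : initY j g = X j ^ g.degreeOf j *
      (yEquiv K j).symm (Polynomial.C (yEquiv K j g).leadingCoeff) := by
    apply (yEquiv K j).injective
    rw [yEquiv_initY, map_mul, map_pow, yEquiv_X, AlgEquiv.apply_symm_apply, mul_comm,
      Polynomial.C_mul_X_pow_eq_monomial]
  refine ⟨by rw [← this]; ring, ?_, this⟩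
  rw [forall_support_apply_eq_zero_iff_natDegree_yEquiv_eq_zero]
  simp

theorem map_idealC (j : Fin n) (G : Set (MvPolynomial (Fin n) K)) :
    (idealC j G).map (yEquiv K j) = (Ideal.span
      ((fun g ↦ (yEquiv K j g).leadingCoeff) '' G)).map Polynomial.C := by
  rw [idealC, Ideal.map_span, Ideal.map_span]
  congr 1
  ext p
  constructor
  · rintro ⟨q, ⟨g, hg, d, r, h⟩, rfl⟩
    exact ⟨_, ⟨g, hg, rfl⟩, h.yEquiv_eq.1.symm⟩
  · rintro ⟨-, ⟨g, hg, rfl⟩, rfl⟩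
    obtain ⟨r, hr⟩ := exists_isYForm j g
    exact ⟨_, ⟨g, hg, _, r, hr⟩, by simp⟩

theorem map_idealN (j : Fin n) (G : Set (MvPolynomial (Fin n) K)) :
    (idealN j G).map (yEquiv K j) = (Ideal.span
      ((fun g ↦ (yEquiv K j g).leadingCoeff) '' {g ∈ G | g.degreeOf j = 0})).map Polynomial.C := by
  rw [idealN, Ideal.map_span, Ideal.map_span]
  apply le_antisymm
  · rw [Ideal.span_le]
    rintro _ ⟨q, ⟨g, hg, r, h⟩, rfl⟩
    by_cases hg0 : g = 0
    · have := h.yEquiv_eq.1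
      rw [hg0, map_zero, Polynomial.leadingCoeff_zero, map_zero] at this
      simp [this]
    · exact Ideal.subset_span ⟨_, ⟨g, ⟨hg, h.yEquiv_eq.2 hg0⟩, rfl⟩, h.yEquiv_eq.1.symm⟩
  · apply Ideal.span_mono
    rintro - ⟨-, ⟨g, ⟨hg, hg0⟩, rfl⟩, rfl⟩
    obtain ⟨r, hr⟩ := exists_isYForm j g
    rw [hg0] at hr
    exact ⟨_, ⟨g, hg, r, hr⟩, by simp⟩

section MonomialOrder

variable {m : MonomialOrder (Fin n)} {j : Fin n}

/-- For a `y`-compatible order the leading monomial of `f` occurs in its initial `y`-form, so it has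
the full degree of `f` in `y`. -/
theorem YCompatible.degreeOf_eq (hm : YCompatible K m j) (f : MvPolynomial (Fin n) K) :
    f.degreeOf j = m.degree f j := by
  by_cases hf : f = 0
  · simp [hf]
  have h1 : initY j f ≠ 0 := by
    rwa [ne_eq, ← m.leadingTerm_eq_zero_iff, ← hm f, m.leadingTerm_eq_zero_iff]
  have h2 : m.degree f = m.degree (initY j f) := by
    rw [← m.degree_leadingTerm f, hm f, m.degree_leadingTerm]
  have h3 := m.degree_mem_support h1
  rw [← h2] at h3
  obtain ⟨a, ha, hfa⟩ := Finset.mem_biUnion.mp (support_sum h3)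
  have := support_monomial_subset hfa
  rw [Finset.mem_singleton] at this
  rw [this, (Finset.mem_filter.mp ha).2]

open scoped MonomialOrder in
/-- With respect to a `y`-compatible order, the exponent of `y` is monotone. -/
theorem YCompatible.apply_le_of_le (hm : YCompatible K m j) {a b : Fin n →₀ ℕ} (hab : a ≼[m] b) :
    a j ≤ b j := by
  classical
  by_cases h : a = b
  · rw [h]
  -- the leading monomial of `x ^ a + x ^ b` is `x ^ b`, and it has the highest power of `y`
  set f : MvPolynomial (Fin n) K := monomial a 1 + monomial b 1 with hf
  have ha : a ∈ f.support := by simp [hf, coeff_monomial, Ne.symm h]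
  have hb : b ∈ f.support := by simp [hf, coeff_monomial, h]
  have hf0 : f ≠ 0 := by
    rintro h0
    simp [h0] at ha
  have hd : m.degree f = b := by
    have := support_add (m.degree_mem_support hf0)
    rcases Finset.mem_union.mp this with h' | h'
    · have h' := Finset.mem_singleton.mp (support_monomial_subset h')
      have := m.le_degree hb
      rw [h'] at this
      exact absurd (m.toSyn.injective (le_antisymm hab this)) h
    · exact Finset.mem_singleton.mp (support_monomial_subset h')
  rw [← hd, ← hm.degreeOf_eq f]
  exact monomial_le_degreeOf j ha

open scoped MonomialOrder in
/-- Division by a Gröbner basis leaves no remainder on the ideal, so every element of the ideal is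
a combination of the basis without terms above its own leading term. -/
theorem IsReducedGroebnerBasis.exists_standard_representation
    {I : Ideal (MvPolynomial (Fin n) K)} {G : Set (MvPolynomial (Fin n) K)}
    (hG : IsReducedGroebnerBasis m I G) {f : MvPolynomial (Fin n) K} (hf : f ∈ I) :
    ∃ h : G →₀ MvPolynomial (Fin n) K, f = h.sum (fun g q ↦ q * (g : MvPolynomial (Fin n) K)) ∧
      ∀ g : G, m.degree ((g : MvPolynomial (Fin n) K) * h g) ≼[m] m.degree f := by
  obtain ⟨h, r, hfr, hdeg, hr⟩ := m.div_set (B := G) (fun g hg ↦ by simp [hG.monic g hg]) f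
  refine ⟨h, ?_, hdeg⟩
  rw [Finsupp.linearCombination_apply] at hfr
  simp only [smul_eq_mul] at hfr
  suffices r = 0 by rwa [this, add_zero] at hfr
  by_contra hr0
  have hrI : r ∈ I := by
    have : r = f - h.sum (fun g q ↦ q * (g : MvPolynomial (Fin n) K)) := by
      rw [hfr]; ring
    rw [this]
    exact sub_mem hf (Ideal.sum_mem _ fun g _ ↦ Ideal.mul_mem_left _ _ (hG.subset g.2))
  have h1 : m.leadingTerm r ∈ initialIdeal m G := by
    rw [hG.initialIdeal_eq]
    exact Ideal.subset_span ⟨r, hrI, rfl⟩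
  rw [initialIdeal, m.span_leadingTerm_eq_span_monomial (fun g hg ↦ by simp [hG.monic g hg])] at h1
  have h2 := Set.image_image (fun s ↦ monomial s (1 : K)) m.degree G
  rw [← h2, mem_ideal_span_monomial_image] at h1
  obtain ⟨-, ⟨g, hg, rfl⟩, hle⟩ := h1 (m.degree r) (by
    have : m.degree (m.leadingTerm r) ∈ (m.leadingTerm r).support :=
      m.degree_mem_support ((m.leadingTerm_eq_zero_iff r).not.mpr hr0)
    rwa [m.degree_leadingTerm] at this)
  exact hr _ (m.degree_mem_support hr0) g hg hle

/-- If `f ∈ I` has degree at most `D` in `y`, the coefficient of `y ^ D` in `f` is generated by the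
leading coefficients of the elements of `G` of degree at most `D` in `y`: by `y`-compatibility, no
summand in a standard representation of `f` exceeds the degree `D` in `y`. The degree of `f` gives
`idealC`, and `D = 0` gives `idealN`. -/
theorem IsReducedGroebnerBasis.coeff_yEquiv_mem_span (hm : YCompatible K m j)
    {I : Ideal (MvPolynomial (Fin n) K)} {G : Set (MvPolynomial (Fin n) K)}
    (hG : IsReducedGroebnerBasis m I G) {f : MvPolynomial (Fin n) K} (hf : f ∈ I) {D : ℕ}
    (hD : f.degreeOf j ≤ D) : (yEquiv K j f).coeff D ∈
      Ideal.span ((fun g ↦ (yEquiv K j g).leadingCoeff) '' {g ∈ G | g.degreeOf j ≤ D}) := by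
  obtain ⟨h, hfh, hdeg⟩ := hG.exists_standard_representation hf
  rw [hfh, Finsupp.sum, map_sum, Polynomial.finsetSum_coeff]
  refine Ideal.sum_mem _ fun g _ ↦ ?_
  by_cases h0 : h g * (g : MvPolynomial (Fin n) K) = 0
  · simp [h0]
  have hle : (h g * (g : MvPolynomial (Fin n) K)).degreeOf j ≤ D := by
    refine le_trans ?_ hD
    rw [hm.degreeOf_eq, hm.degreeOf_eq, mul_comm]
    exact hm.apply_le_of_le (hdeg g)
  rw [← natDegree_yEquiv, map_mul] at hle
  rw [map_mul]
  have h1 : yEquiv K j (h g) ≠ 0 := by simpa using left_ne_zero_of_mul h0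
  have h2 : yEquiv K j g ≠ 0 := by simpa using right_ne_zero_of_mul h0
  have h3 := Polynomial.natDegree_mul h1 h2
  rcases hle.lt_or_eq with hlt | heq
  · rw [Polynomial.coeff_eq_zero_of_natDegree_lt hlt]
    exact zero_mem _
  · rw [← heq, Polynomial.coeff_natDegree, Polynomial.leadingCoeff_mul]
    refine Ideal.mul_mem_left _ _ (Ideal.subset_span ⟨g, ⟨g.2, ?_⟩, rfl⟩)
    rw [← natDegree_yEquiv]
    omega

/-- `C_{y,I}` is extended from the ideal of leading coefficients of `I` with respect to `y`. -/
theorem IsReducedGroebnerBasis.map_idealC_eq (hm : YCompatible K m j)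
    {I : Ideal (MvPolynomial (Fin n) K)} {G : Set (MvPolynomial (Fin n) K)}
    (hG : IsReducedGroebnerBasis m I G) : (idealC j G).map (yEquiv K j) =
      ((I.map (yEquiv K j)).leadingCoeff).map Polynomial.C := by
  rw [map_idealC]
  congr 1
  apply le_antisymm
  · rw [Ideal.span_le]
    rintro - ⟨g, hg, rfl⟩
    exact (Ideal.mem_leadingCoeff _ _).mpr ⟨_, Ideal.mem_map_of_mem _ (hG.subset hg), rfl⟩
  · intro c hc
    obtain ⟨p, hp, rfl⟩ := (Ideal.mem_leadingCoeff _ _).mp hc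
    obtain ⟨f, hf, rfl⟩ := (Ideal.mem_map_of_equiv (yEquiv K j) p).mp hp
    exact Ideal.span_mono (Set.image_mono fun g hg ↦ hg.1)
      (hG.coeff_yEquiv_mem_span hm hf (natDegree_yEquiv j f).ge)

/-- `N_{y,I}` is extended from the ideal of the elements of `I` that do not involve `y`. -/
theorem IsReducedGroebnerBasis.map_idealN_eq (hm : YCompatible K m j)
    {I : Ideal (MvPolynomial (Fin n) K)} {G : Set (MvPolynomial (Fin n) K)}
    (hG : IsReducedGroebnerBasis m I G) : (idealN j G).map (yEquiv K j) =
      ((I.map (yEquiv K j)).comap Polynomial.C).map Polynomial.C := by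
  rw [map_idealN]
  congr 1
  apply le_antisymm
  · rw [Ideal.span_le]
    rintro - ⟨g, ⟨hg, hg0⟩, rfl⟩
    rw [← natDegree_yEquiv] at hg0
    change Polynomial.C ((yEquiv K j g).coeff (yEquiv K j g).natDegree) ∈ I.map (yEquiv K j)
    rw [hg0, ← Polynomial.eq_C_of_natDegree_eq_zero hg0]
    exact Ideal.mem_map_of_mem _ (hG.subset hg)
  · intro c hc
    obtain ⟨f, hf, hfc⟩ := (Ideal.mem_map_of_equiv (yEquiv K j) _).mp (Ideal.mem_comap.mp hc)
    have hD : f.degreeOf j ≤ 0 := by rw [← natDegree_yEquiv, hfc, Polynomial.natDegree_C]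
    have := hG.coeff_yEquiv_mem_span hm hf hD
    rw [hfc, Polynomial.coeff_C_zero] at this
    simpa using this

end MonomialOrder

end KMY

/-! ### Equidimensionality and heights -/

namespace KMY

theorem height_eq_of_forall_minimalPrimes {R : Type*} [CommRing R] {J : Ideal R} {h : ℕ∞}
    (hJ : J ≠ ⊤) (hh : ∀ P ∈ J.minimalPrimes, P.height = h) : J.height = h := by
  obtain ⟨P, hP⟩ := Ideal.nonempty_minimalPrimes hJ
  rw [Ideal.height_eq_inf_minimalPrimes]
  exact le_antisymm ((iInf₂_le P hP).trans (hh P hP).le) (le_iInf₂ fun Q hQ ↦ (hh Q hQ).ge)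

theorem ringKrullDim_quotient_eq_of_forall_minimalPrimes {R : Type*} [CommRing R] {J : Ideal R}
    {d : WithBot ℕ∞} (hJ : J ≠ ⊤) (hd : ∀ P ∈ J.minimalPrimes, ringKrullDim (R ⧸ P) = d) :
    ringKrullDim (R ⧸ J) = d := by
  apply le_antisymm
  · rw [ringKrullDim_quotient]
    refine iSup_le fun l ↦ ?_
    have hx := l.head.2
    have := l.head.1.isPrime
    obtain ⟨P, hP, hPl⟩ := Ideal.exists_minimalPrimes_le (I := J) (J := l.head.1.asIdeal) hx
    rw [← hd P hP, ringKrullDim_quotient]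
    -- a chain of primes over `J` lies over some minimal prime of `J`
    let l' : LTSeries (PrimeSpectrum.zeroLocus (P : Set R)) :=
      { length := l.length
        toFun := fun i ↦ ⟨(l i).1, hPl.trans (l.head_le i)⟩
        step := fun i ↦ l.step i }
    exact le_iSup (fun L : LTSeries (PrimeSpectrum.zeroLocus (P : Set R)) ↦
      ((L.length : ℕ) : WithBot ℕ∞)) l'
  · obtain ⟨P, hP⟩ := Ideal.nonempty_minimalPrimes hJ
    rw [← hd P hP]
    exact ringKrullDim_le_of_surjective (Ideal.Quotient.factor hP.1.2)
      (Ideal.Quotient.factor_surjective hP.1.2)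

/-- Over a finitely generated domain over a field, the dimension formula turns equidimensionality
into a condition on heights. -/
theorem quotientEquidimensional_iff_forall_height_eq (k : Type*) {A : Type*} [Field k] [CommRing A]
    [IsDomain A] [Algebra k A] [Algebra.FiniteType k A] {J : Ideal A} (hJ : J ≠ ⊤) :
    QuotientEquidimensional J ↔ ∀ P ∈ J.minimalPrimes, P.height = J.height := by
  obtain ⟨N, hN⟩ := exists_ringKrullDim_eq_natCast k A
  obtain ⟨P₀, hP₀⟩ := Ideal.nonempty_minimalPrimes hJ
  have := hP₀.1.1
  obtain ⟨a₀, b₀, ha₀, hb₀, hab₀⟩ := exists_height_add_ringKrullDim_quotient k hN P₀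
  constructor
  · intro h
    have key : ∀ P ∈ J.minimalPrimes, P.height = P₀.height := by
      intro P hP
      have := hP.1.1
      obtain ⟨a, b, ha, hb, hab⟩ := exists_height_add_ringKrullDim_quotient k hN P
      have e := (h P hP).trans (h P₀ hP₀).symm
      rw [hb, hb₀] at e
      rw [ha, ha₀]
      norm_cast at e ⊢
      omega
    intro P hP
    rw [height_eq_of_forall_minimalPrimes hJ key, key P hP]
  · intro h
    have key : ∀ P ∈ J.minimalPrimes, ringKrullDim (A ⧸ P) = ringKrullDim (A ⧸ P₀) := by
      intro P hP
      have := hP.1.1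
      obtain ⟨a, b, ha, hb, hab⟩ := exists_height_add_ringKrullDim_quotient k hN P
      have e := (h P hP).trans (h P₀ hP₀).symm
      rw [ha, ha₀] at e
      rw [hb, hb₀]
      norm_cast at e ⊢
      omega
    intro P hP
    rw [ringKrullDim_quotient_eq_of_forall_minimalPrimes hJ key, key P hP]

theorem exists_mem_minimalPrimes_map_height_eq {R S : Type*} [CommRing R] [CommRing S]
    (e : R ≃+* S) {I : Ideal R} {P : Ideal R} (hP : P ∈ I.minimalPrimes) :
    ∃ Q ∈ (I.map e).minimalPrimes, P.height = Q.height := by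
  rw [← Ideal.comap_map_of_bijective e e.bijective (I := I)] at hP
  obtain ⟨Q, hQ, rfl⟩ := Ideal.exists_minimalPrimes_comap_eq (e : R →+* S) P hP
  exact ⟨Q, hQ, e.height_comap Q⟩

theorem exists_mem_minimalPrimes_height_eq_of_mem_minimalPrimes_map {R S : Type*} [CommRing R]
    [CommRing S] (e : R ≃+* S) {I : Ideal R} {Q : Ideal S} (hQ : Q ∈ (I.map e).minimalPrimes) :
    ∃ P ∈ I.minimalPrimes, P.height = Q.height := by
  rw [← Ideal.comap_symm] at hQ
  obtain ⟨P, hP, rfl⟩ := Ideal.exists_minimalPrimes_comap_eq (e.symm : S →+* R) Q hQ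
  exact ⟨P, hP, (e.symm.height_comap P).symm⟩

theorem radical_le_radical_of_map_equiv {R S : Type*} [CommRing R] [CommRing S] (e : R ≃+* S)
    {I J : Ideal R} (h : I.map e ≤ (J.map e).radical) : I.radical ≤ J.radical := by
  rw [Ideal.radical_le_radical_iff]
  intro f hf
  obtain ⟨k, hk⟩ := h (Ideal.mem_map_of_mem e hf)
  rw [← map_pow] at hk
  obtain ⟨g, hg, hgf⟩ := (Ideal.mem_map_of_equiv e _).mp hk
  exact ⟨k, e.injective hgf ▸ hg⟩

/-- The commutative algebra behind the nondegenerate decomposition: `C` and `N` are extended from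
the leading coefficients, respectively the constants, of an equidimensional ideal `I` of a polynomial
ring in one variable. The identification `e` with this ring is arbitrary. -/
theorem height_eq_of_map_eq_leadingCoeff (k : Type*) {R A : Type*} [Field k] [CommRing R]
    [CommRing A] [IsDomain R] [IsDomain A] [Algebra k R] [Algebra k A] [Algebra.FiniteType k R]
    [Algebra.FiniteType k A] (e : R ≃+* Polynomial A) {I C N : Ideal R}
    (hI : QuotientEquidimensional I)
    (hC : C.map e = (I.map e).leadingCoeff.map Polynomial.C)
    (hN : N.map e = ((I.map e).comap Polynomial.C).map Polynomial.C)
    (hNC : ¬ C.radical ≤ N.radical) (hCtop : C ≠ ⊤) :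
    C.height = I.height ∧ I.height = N.height + 1 ∧ QuotientEquidimensional C := by
  have := Algebra.FiniteType.isNoetherianRing k A
  have hL : (I.map e).leadingCoeff ≠ ⊤ := by
    intro h
    rw [h, Ideal.map_top] at hC
    apply hCtop
    rw [← Ideal.comap_map_of_bijective e e.bijective (I := C), hC, Ideal.comap_top]
  have hItop : I ≠ ⊤ := by
    rintro rfl
    refine hL ((Ideal.eq_top_iff_one _).mpr ((Ideal.mem_leadingCoeff _ _).mpr ⟨1, ?_, by simp⟩))
    rw [Ideal.map_top]
    trivial
  have hIht := (quotientEquidimensional_iff_forall_height_eq k hItop).mp hI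
  have hJht : ∀ P ∈ (I.map e).minimalPrimes, P.height = I.height := by
    intro P hP
    obtain ⟨Q, hQ, hQP⟩ := exists_mem_minimalPrimes_height_eq_of_mem_minimalPrimes_map e hP
    rw [← hQP, hIht Q hQ]
  have hLht : ∀ p ∈ (I.map e).leadingCoeff.minimalPrimes, p.height = I.height := fun p hp ↦
    height_of_mem_minimalPrimes_leadingCoeff k hJht hp
  have hCht : C.height = I.height := by
    rw [← e.height_map, hC, height_ideal_map_C]
    exact height_eq_of_forall_minimalPrimes hL hLht
  refine ⟨hCht, ?_, ?_⟩
  · rw [← e.height_map N, hN, height_ideal_map_C]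
    refine (height_comap_C_add_one hJht fun hle ↦ hNC ?_).symm
    refine radical_le_radical_of_map_equiv e ?_
    rw [hC, hN]
    exact (Ideal.map_mono hle).trans (Ideal.map_radical_le _)
  · rw [quotientEquidimensional_iff_forall_height_eq k hCtop, hCht]
    intro Q hQ
    obtain ⟨Q', hQ', hQQ'⟩ := exists_mem_minimalPrimes_map_height_eq e hQ
    rw [hC] at hQ'
    obtain ⟨p, hp, rfl⟩ := exists_eq_map_C_of_mem_minimalPrimes_map_C hQ'
    have := hp.1.1
    rw [hQQ', height_map_C_of_isPrime p, hLht p hp]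

end KMY

theorem mainTheorem5 {K : Type*} [Field K] {n : ℕ} (j : Fin n) (m : MonomialOrder (Fin n))
    (hm : KMY.YCompatible K m j)
    (I : Ideal (MvPolynomial (Fin n) K)) (hI : KMY.QuotientEquidimensional I)
    (G : Set (MvPolynomial (Fin n) K)) (hG : KMY.IsReducedGroebnerBasis m I G)
    (hnondeg : ¬ KMY.Degenerate j G) :
    (KMY.idealC j G).height = I.height ∧
      I.height = (KMY.idealN j G).height + 1 ∧
      KMY.QuotientEquidimensional (KMY.idealC j G) := by
  rw [KMY.Degenerate, not_or] at hnondeg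
  have hle : KMY.idealN j G ≤ KMY.idealC j G :=
    Ideal.span_mono fun q ⟨g, hg, r, h⟩ ↦ ⟨g, hg, 0, r, h⟩
  exact KMY.height_eq_of_map_eq_leadingCoeff K (KMY.yEquiv K j).toRingEquiv hI
    (hG.map_idealC_eq hm) (hG.map_idealN_eq hm)
    (fun h ↦ hnondeg.1 (h.antisymm (Ideal.radical_mono hle))) hnondeg.2
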